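/- Let $f:\mathbb R\to\mathbb R$ be bounded and globally Lipschitz continuous with $f(0)=0$, and let $\beta,L\in(0,\infty)$ and $x_0\in(0,L)$. Let $H^1_L=H^1_0((-L,L))$ be the real Sobolev space with norm $\|u\|^2=\int_{-L}^{L}u^2\,dx+\int_{-L}^{L}u_x^2\,dx$, let $H^{-1}_L$ be its dual, with $H^1_L\subset H^{-1}_L$ through the $L^2$ inner product, let $A_L:H^1_L\to H^{-1}_L$ be the operator induced by the Dirichlet form $a(u,v)=\int_{-L}^{L}u_xv_x\,dx$, and for $x\in(-L,L)$ let $\delta_x\in H^{-1}_L$ be the evaluation $\langle\delta_x,u\rangle=u(x)$ of the continuous representative. Consider the nonlinear Dirichlet problem $$u_t+A_Lu=-f\bigl(\beta\langle\delta_{x_0},u\rangle\bigr)\,\delta_0\ \text{ in } H^{-1}_L \text{ for } t>0,\qquad u(0)=u_0\in H^1_L, \tag{1}$$ whose solutions are the $u\in C([0,\infty),H^1_L)$ that are differentiable in $H^{-1}_L$ at every $t>0$ and satisfy (1). Then (1) generates a unique continuous semiflow $\Phi_\beta$ on $H^1_L$: for every $u_0\in H^1_L$ the orbit $t\mapsto\Phi_\beta(t,u_0)$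 is the unique solution of (1). Moreover, for every $u_0\in H^1_L$, as $t\to\infty$, $$\Phi_\beta(t,u_0)\longrightarrow 0 \text{ in } H^1_L\iff \bigl(\Phi_\beta(t,u_0)\bigr)(x_0)\longrightarrow 0\text{ in }\mathbb R .$$ -/

import Mathlib

open Set Filter Topology MeasureTheory
open scoped NNReal ContDiff

namespace ParabolicOscillator

/-- The real Hilbert space `L²(-L, L)`. -/
abbrev L2 (L : ℝ) : Type := Lp ℝ 2 (volume.restrict (Ioo (-L) L))

/-- The test functions `C_c^∞((-L, L))`. -/
structure IsTestFunction (L : ℝ) (φ : ℝ → ℝ) : Prop where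
  smooth : ContDiff ℝ ∞ φ
  compact : HasCompactSupport φ
  support : tsupport φ ⊆ Ioo (-L) L

lemma IsTestFunction.continuous_deriv {L : ℝ} {φ : ℝ → ℝ} (h : IsTestFunction L φ) :
    Continuous (deriv φ) :=
  h.smooth.continuous_deriv (by simp)

/-- The pairs `(φ, φ')`, for `φ` a test function, as a subspace of `L² × L²`. The norm of
`WithLp 2 (L2 L × L2 L)` is `‖(u, g)‖² = ‖u‖² + ‖g‖²`, so on these pairs it is the `H¹` norm. -/
noncomputable def testPairs (L : ℝ) : Submodule ℝ (WithLp 2 (L2 L × L2 L)) where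
  carrier := {w | ∃ φ, IsTestFunction L φ ∧
    w.fst =ᵐ[volume.restrict (Ioo (-L) L)] φ ∧
    w.snd =ᵐ[volume.restrict (Ioo (-L) L)] deriv φ}
  zero_mem' := by
    refine ⟨0, ⟨contDiff_const, HasCompactSupport.zero, by simp [tsupport]⟩, ?_, ?_⟩
    · exact Lp.coeFn_zero _ _ _
    · have : deriv (0 : ℝ → ℝ) = 0 := by ext x; simp
      rw [this]
      exact Lp.coeFn_zero _ _ _
  add_mem' := by
    rintro a b ⟨φ, hφ, ha1, ha2⟩ ⟨ψ, hψ, hb1, hb2⟩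
    refine ⟨φ + ψ, ⟨hφ.smooth.add hψ.smooth, hφ.compact.add hψ.compact, ?_⟩, ?_, ?_⟩
    · exact (tsupport_add φ ψ).trans (union_subset hφ.support hψ.support)
    · exact (Lp.coeFn_add a.fst b.fst).trans (ha1.add hb1)
    · have : deriv (φ + ψ) = deriv φ + deriv ψ := by
        ext x
        exact deriv_add (hφ.smooth.differentiable (by simp) x)
          (hψ.smooth.differentiable (by simp) x)
      rw [this]
      exact (Lp.coeFn_add a.snd b.snd).trans (ha2.add hb2)
  smul_mem' := by
    rintro c a ⟨φ, hφ, ha1, ha2⟩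
    refine ⟨c • φ, ⟨hφ.smooth.const_smul c, hφ.compact.smul_left (f := fun _ => c), ?_⟩, ?_, ?_⟩
    · exact (tsupport_smul_subset_right (fun _ => c) φ).trans hφ.support
    · exact (Lp.coeFn_smul c a.fst).trans (ha1.const_smul c)
    · have : deriv (c • φ) = c • deriv φ := by
        ext x
        exact deriv_const_smul c (hφ.smooth.differentiable (by simp) x)
      rw [this]
      exact (Lp.coeFn_smul c a.snd).trans (ha2.const_smul c)

/-- The Sobolev space `H¹_L = H¹₀((-L, L))`: the closure of the test functions in the `H¹` norm
`‖u‖² = ∫ u² + ∫ (u')²`. An element is stored as the pair `(u, u')` of a function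
and its weak derivative, both in `L²(-L, L)`. -/
noncomputable abbrev H10 (L : ℝ) : Submodule ℝ (WithLp 2 (L2 L × L2 L)) := (testPairs L).topologicalClosure

/-- The dual `H⁻¹_L = (H¹_L)'`, with the dual norm. -/
abbrev Hneg1 (L : ℝ) : Type := H10 L →L[ℝ] ℝ

/-- The inclusion `H¹_L → L²(-L, L)`. -/
noncomputable def val (L : ℝ) : H10 L →L[ℝ] L2 L :=
  (WithLp.fstL 2 ℝ (L2 L) (L2 L)).comp (H10 L).subtypeL

/-- The weak derivative `H¹_L → L²(-L, L)`, `u ↦ u_x`. -/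
noncomputable def grad (L : ℝ) : H10 L →L[ℝ] L2 L :=
  (WithLp.sndL 2 ℝ (L2 L) (L2 L)).comp (H10 L).subtypeL

/-- The inclusion `H¹_L ⊂ H⁻¹_L` through the inner product of `L²(-L, L)`. -/
noncomputable def incl (L : ℝ) : H10 L →L[ℝ] Hneg1 L :=
  (innerSL ℝ : L2 L →L[ℝ] L2 L →L[ℝ] ℝ).bilinearComp (val L) (val L)

/-- The operator `A_L : H¹_L → H⁻¹_L` induced by the Dirichlet form
`a(u, v) = ∫_{-L}^{L} u_x v_x dx`. -/
noncomputable def dirichletOp (L : ℝ) : H10 L →L[ℝ] Hneg1 L :=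
  (innerSL ℝ : L2 L →L[ℝ] L2 L →L[ℝ] ℝ).bilinearComp (grad L) (grad L)

/-- The evaluation functional `δ_x ∈ H⁻¹_L`, `⟨δ_x, u⟩ = u(x)`, where `u` is identified with its
continuous representative `x ↦ ∫_{-L}^{x} u_x(s) ds`. -/
noncomputable def delta (L x : ℝ) : Hneg1 L :=
  (innerSL ℝ (indicatorConstLp 2 (μ := volume.restrict (Ioo (-L) L)) (measurableSet_Iic (a := x))
    (measure_ne_top _ _) (1 : ℝ))).comp (grad L)

lemma incl_apply (L : ℝ) (u v : H10 L) :
    incl L u v = ∫ x in Ioo (-L) L, val L u x * val L v x := by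
  change inner ℝ (val L u) (val L v) = _
  rw [L2.inner_def]
  exact integral_congr_ae (Eventually.of_forall fun x => mul_comm _ _)

lemma dirichletOp_apply (L : ℝ) (u v : H10 L) :
    dirichletOp L u v = ∫ x in Ioo (-L) L, grad L u x * grad L v x := by
  change inner ℝ (grad L u) (grad L v) = _
  rw [L2.inner_def]
  exact integral_congr_ae (Eventually.of_forall fun x => mul_comm _ _)

lemma delta_apply (L x : ℝ) (u : H10 L) :
    delta L x u = ∫ s in Iic x, grad L u s ∂(volume.restrict (Ioo (-L) L)) := by
  simp only [delta, ContinuousLinearMap.comp_apply, innerSL_apply_apply]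
  exact L2.inner_indicatorConstLp_one _ _ _

/-- Every test function defines an element of `H¹_L`. -/
lemma exists_of_test {L : ℝ} {φ : ℝ → ℝ} (hφ : IsTestFunction L φ) :
    ∃ u : H10 L, val L u =ᵐ[volume.restrict (Ioo (-L) L)] φ ∧
      grad L u =ᵐ[volume.restrict (Ioo (-L) L)] deriv φ := by
  have h1 : MemLp φ 2 (volume.restrict (Ioo (-L) L)) :=
    (hφ.smooth.continuous.memLp_of_hasCompactSupport hφ.compact).restrict _
  have h2 : MemLp (deriv φ) 2 (volume.restrict (Ioo (-L) L)) :=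
    (hφ.continuous_deriv.memLp_of_hasCompactSupport hφ.compact.deriv).restrict _
  refine ⟨⟨WithLp.toLp 2 (h1.toLp φ, h2.toLp (deriv φ)), ?_⟩, h1.coeFn_toLp, h2.coeFn_toLp⟩
  exact (testPairs L).le_topologicalClosure ⟨φ, hφ, h1.coeFn_toLp, h2.coeFn_toLp⟩

/-- On test functions, `δ_x` is the evaluation at `x`. -/
lemma delta_of_test {L : ℝ} {φ : ℝ → ℝ} (hφ : IsTestFunction L φ) (u : H10 L)
    (hu : grad L u =ᵐ[volume.restrict (Ioo (-L) L)] deriv φ) (x : ℝ) :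
    delta L x u = φ x := by
  rw [delta_apply, integral_congr_ae (ae_restrict_of_ae hu),
    Measure.restrict_restrict measurableSet_Iic,
    ← setIntegral_eq_of_subset_of_forall_sdiff_eq_zero measurableSet_Iic
      (inter_subset_left : Iic x ∩ Ioo (-L) L ⊆ Iic x)]
  · exact HasCompactSupport.integral_Iic_deriv_eq (hφ.smooth.of_le (by simp)) hφ.compact x
  · intro s hs
    have : s ∉ tsupport φ := fun h => hs.2 ⟨hs.1, hφ.support h⟩
    exact Function.notMem_support.1 fun h => this (support_deriv_subset h)

/-- Every `u ∈ H¹_L` agrees almost everywhere with `x ↦ ⟨δ_x, u⟩`. -/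
lemma val_ae_eq_delta (L : ℝ) (u : H10 L) :
    val L u =ᵐ[volume.restrict (Ioo (-L) L)] fun x => delta L x u := by
  obtain ⟨w, hw⟩ := u
  obtain ⟨v, hv, hlim⟩ := mem_closure_iff_seq_limit.1 hw
  have hmem : ∀ n, v n ∈ H10 L := fun n => (testPairs L).le_topologicalClosure (hv n)
  have hlim' : Tendsto (fun n => (⟨v n, hmem n⟩ : H10 L)) atTop (𝓝 ⟨w, hw⟩) :=
    tendsto_subtype_rng.2 hlim
  have hval := ((val L).continuous.tendsto _).comp hlim'
  obtain ⟨ns, hns, hae⟩ := (tendstoInMeasure_of_tendsto_Lp hval).exists_seq_tendsto_ae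
  have heq : ∀ n, ∀ᵐ x ∂volume.restrict (Ioo (-L) L),
      val L ⟨v n, hmem n⟩ x = delta L x ⟨v n, hmem n⟩ := by
    intro n
    obtain ⟨φ, hφ, h1, h2⟩ := hv n
    filter_upwards [h1] with x hx
    rw [delta_of_test hφ ⟨v n, hmem n⟩ h2 x]
    exact hx
  filter_upwards [hae, ae_all_iff.2 heq] with x hx hxe
  refine tendsto_nhds_unique hx ?_
  have := (((delta L x).continuous.tendsto _).comp hlim').comp hns.tendsto_atTop
  refine this.congr fun n => ?_
  exact (hxe (ns n)).symm

/-- `u ∈ C([0, ∞), H¹_L)` is a global solution of the Cauchy problem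
`u_t + A_L u = - f(β ⟨δ_{x₀}, u⟩) δ₀` in `H⁻¹_L` for `t > 0`, with `u(0) = u₀`. -/
structure IsSolution (f : ℝ → ℝ) (β L x₀ : ℝ) (u₀ : H10 L) (u : ℝ≥0 → H10 L) : Prop where
  continuous : Continuous u
  initial : u 0 = u₀
  hasDerivAt : ∀ t : ℝ≥0, 0 < t →
    HasDerivAt (fun s : ℝ => incl L (u s.toNNReal))
      (-(dirichletOp L (u t)) - f (β * delta L x₀ (u t)) • delta L 0) (t : ℝ)

/-- `Φ` is the semiflow on `H¹_L` generated by the Cauchy problem: for every initial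
value `u₀` the orbit `t ↦ Φ(t, u₀)` is the one and only global solution. -/
def IsSemiflowOf (f : ℝ → ℝ) (β L x₀ : ℝ) (Φ : Flow ℝ≥0 (H10 L)) : Prop :=
  ∀ (u₀ : H10 L) (u : ℝ≥0 → H10 L), IsSolution f β L x₀ u₀ u ↔ u = fun t => Φ t u₀

end ParabolicOscillator

/-! The forcing is a scalar signal `r` times one fixed functional `d`, so the linear problem
decouples. In the full `H¹` inner product, the `L²` form `J` has a Hilbert basis of eigenvectors,
because `H¹₀ → L²` is compact; its eigenvalues `μ i` are positive and, by Poincaré, at most some `θ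
< 1` (`exists_diagonalizes`). Under the Riesz identification `A` is `1 - J`, and the coordinates
satisfy `c' = -(1/μ i - 1) c - (d (b i)/μ i) r`.

If `|r| ≤ R exp (γ t)`, Duhamel bounds the forced part of the coordinate by `R exp (γ t) |d (b i)| /
(1 - μ i + γ μ i)`. The singular factor `1/μ i` has cancelled, and `d (b i)` is square summable by
Riesz; this controls `u` in `H¹` although `d` lies only in the dual
(`norm_sq_le_of_isLinearSolution`).

For large `γ` the resulting constant is arbitrarily small (`tendsto_forcingBound`). The semilinear
problem is then a contraction in a weighted sup norm, with Lipschitz dependence on data; this gives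
the semiflow (`exists_flow`). For `γ = 0` the free part decays exponentially, so a forcing that
tends to zero drives the solution to zero (`tendsto_zero_of_isLinearSolution`). Since `f 0 = 0`,
decay of the value at `x₀` makes the forcing decay; the converse is continuity of `δ_{x₀}`. -/

namespace ParabolicOscillator

/-! ### Scalar Duhamel estimates with exponential weight -/

section Scalar

/-- One-sided exponential estimate for the scalar equation `c' = -lam c - κ r`. -/
lemma le_of_hasDerivAt_linear {c r : ℝ → ℝ} {lam κ R γ T : ℝ} (hT : 0 ≤ T) (hlam : 0 < lam + γ)
    (hR : 0 ≤ R) (hc : ContinuousOn c (Icc 0 T))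
    (hd : ∀ t ∈ Ioo 0 T, HasDerivAt c (-lam * c t - κ * r t) t)
    (hr : ∀ t ∈ Ioo 0 T, |r t| ≤ R * Real.exp (γ * t)) :
    c T ≤ Real.exp (-lam * T) * c 0 + |κ| * R * Real.exp (γ * T) / (lam + γ) := by
  -- Integrating factor times `c`, minus the primitive of the largest possible forcing; the
  -- difference can only decrease.
  set g : ℝ → ℝ := fun s => Real.exp (lam * s) * c s -
    |κ| * R * Real.exp ((lam + γ) * s) / (lam + γ) with hg
  have hexp : ∀ a t : ℝ, HasDerivAt (fun s => Real.exp (a * s)) (Real.exp (a * t) * a) t := by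
    intro a t
    simpa using ((hasDerivAt_id t).const_mul a).exp
  have hder : ∀ t ∈ Ioo 0 T, HasDerivAt g
      (Real.exp (lam * t) * (-κ * r t) - |κ| * R * Real.exp ((lam + γ) * t)) t := by
    intro t ht
    have h := ((hexp lam t).mul (hd t ht)).sub
      (((hexp (lam + γ) t).const_mul (|κ| * R)).div_const (lam + γ))
    refine h.congr_deriv ?_
    field_simp
    ring
  have hanti : AntitoneOn g (Icc 0 T) := by
    refine antitoneOn_of_deriv_nonpos (convex_Icc 0 T) ?_ ?_ ?_
    · refine ContinuousOn.sub (ContinuousOn.mul (by fun_prop) hc) (by fun_prop)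
    · rw [interior_Icc]
      exact fun t ht => (hder t ht).differentiableAt.differentiableWithinAt
    · rw [interior_Icc]
      intro t ht
      rw [(hder t ht).deriv]
      have h1 : -κ * r t ≤ |κ| * (R * Real.exp (γ * t)) := by
        calc -κ * r t ≤ |-κ * r t| := le_abs_self _
          _ = |κ| * |r t| := by rw [abs_mul, abs_neg]
          _ ≤ _ := by gcongr; exact hr t ht
      have h2 := mul_le_mul_of_nonneg_left h1 (Real.exp_nonneg (lam * t))
      rw [add_mul, Real.exp_add]
      nlinarith
  have h := hanti (left_mem_Icc.2 hT) (right_mem_Icc.2 hT) hT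
  simp only [hg, mul_zero, Real.exp_zero, one_mul, mul_one] at h
  have h3 : 0 ≤ |κ| * R / (lam + γ) := by positivity
  have h4 : Real.exp (lam * T) * c T ≤ c 0 + |κ| * R * Real.exp ((lam + γ) * T) / (lam + γ) := by
    linarith
  have h5 := mul_le_mul_of_nonneg_left h4 (Real.exp_nonneg (-lam * T))
  have h6 : Real.exp (-lam * T) * Real.exp (lam * T) = 1 := by
    rw [← Real.exp_add]; simp
  have h7 : Real.exp (-lam * T) * Real.exp ((lam + γ) * T) = Real.exp (γ * T) := by
    rw [← Real.exp_add]; congr 1; ring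
  calc c T = Real.exp (-lam * T) * (Real.exp (lam * T) * c T) := by rw [← mul_assoc, h6, one_mul]
    _ ≤ _ := h5
    _ = Real.exp (-lam * T) * c 0 + |κ| * R *
      (Real.exp (-lam * T) * Real.exp ((lam + γ) * T)) / (lam + γ) := by ring
    _ = _ := by rw [h7]

lemma abs_le_of_hasDerivAt_linear {c r : ℝ → ℝ} {lam κ R γ T : ℝ} (hT : 0 ≤ T)
    (hlam : 0 < lam + γ) (hR : 0 ≤ R) (hc : ContinuousOn c (Icc 0 T))
    (hd : ∀ t ∈ Ioo 0 T, HasDerivAt c (-lam * c t - κ * r t) t)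
    (hr : ∀ t ∈ Ioo 0 T, |r t| ≤ R * Real.exp (γ * t)) :
    |c T| ≤ Real.exp (-lam * T) * |c 0| + |κ| * R * Real.exp (γ * T) / (lam + γ) := by
  refine abs_le'.2 ⟨?_, ?_⟩
  · refine (le_of_hasDerivAt_linear hT hlam hR hc hd hr).trans ?_
    gcongr
    exact le_abs_self _
  · have := le_of_hasDerivAt_linear (c := fun t => -c t) (κ := -κ) hT hlam hR hc.neg
      (fun t ht => (hd t ht).fun_neg.congr_deriv (by ring)) hr
    rw [abs_neg] at this
    refine this.trans ?_
    gcongr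
    exact neg_le_abs _

end Scalar

/-! ### Coordinates in a Hilbert basis -/

section Hilbert

variable {ι V : Type*} [NormedAddCommGroup V] [InnerProductSpace ℝ V]

lemma hasSum_sq_inner (b : HilbertBasis ι ℝ V) (x : V) :
    HasSum (fun i => inner ℝ (b i) x ^ 2) (‖x‖ ^ 2) := by
  have h := b.hasSum_inner_mul_inner x x
  rw [real_inner_self_eq_norm_sq] at h
  refine h.congr_fun ?_
  intro i
  rw [real_inner_comm x (b i), sq]

lemma summable_sq_apply [CompleteSpace V] (b : HilbertBasis ι ℝ V) (d : V →L[ℝ] ℝ) :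
    Summable (fun i => d (b i) ^ 2) := by
  refine (hasSum_sq_inner b ((InnerProductSpace.toDual ℝ V).symm d)).summable.congr ?_
  intro i
  rw [real_inner_comm, InnerProductSpace.toDual_symm_apply]

lemma ext_basis (b : HilbertBasis ι ℝ V) {φ ψ : V →L[ℝ] ℝ} (h : ∀ i, φ (b i) = ψ (b i)) :
    φ = ψ := by
  refine ContinuousLinearMap.ext_on (s := Set.range b) ?_ ?_
  · rw [dense_iff_closure_eq, ← Submodule.topologicalClosure_coe, b.dense_span]; rfl
  · rintro _ ⟨i, rfl⟩; exact h i

/-- A curve can be prescribed by continuous coordinates dominated by a square summable family. -/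
lemma exists_continuous_of_coordinates {X : Type*} [TopologicalSpace X] (b : HilbertBasis ι ℝ V)
    {c : ι → X → ℝ} {B : ι → ℝ} (hB : Summable fun i => B i ^ 2)
    (hc : ∀ i, Continuous (c i)) (hcB : ∀ i t, |c i t| ≤ B i) :
    ∃ u : X → V, Continuous u ∧ ∀ i t, inner ℝ (b i) (u t) = c i t := by
  have hmem : ∀ t, Memℓp (fun i => c i t) 2 := by
    intro t
    refine memℓp_gen ?_
    refine hB.of_nonneg_of_le (fun i => by positivity) fun i => ?_
    have : ‖c i t‖ ≤ B i := hcB i t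
    simp only [ENNReal.toReal_ofNat, Real.rpow_ofNat]
    gcongr
  refine ⟨fun t => b.repr.symm ⟨fun i => c i t, hmem t⟩, ?_, ?_⟩
  swap
  · intro i t
    rw [← b.repr_apply_apply, LinearIsometryEquiv.apply_symm_apply]
  · have hcoord : ∀ i t, inner ℝ (b i) (b.repr.symm ⟨fun i => c i t, hmem t⟩) = c i t := by
      intro i t
      rw [← b.repr_apply_apply, LinearIsometryEquiv.apply_symm_apply]
    rw [continuous_iff_continuousAt]
    intro t
    rw [ContinuousAt, tendsto_iff_norm_sub_tendsto_zero]
    -- By Parseval this sum is the squared distance of the two points of the curve.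
    have key : Tendsto (fun s => ∑' i, (c i s - c i t) ^ 2) (𝓝 t) (𝓝 (∑' _ : ι, 0)) := by
      refine tendsto_tsum_of_dominated_convergence (bound := fun i => 4 * B i ^ 2)
        (hB.mul_left 4) (fun i => ?_) (Eventually.of_forall fun s i => ?_)
      · have : Tendsto (fun s => (c i s - c i t) ^ 2) (𝓝 t) (𝓝 ((c i t - c i t) ^ 2)) :=
          (((hc i).tendsto t).sub_const _).pow 2
        simpa using this
      · have h1 : |c i s - c i t| ≤ 2 * B i :=
          (abs_sub _ _).trans (by linarith [hcB i s, hcB i t])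
        rw [Real.norm_eq_abs, abs_pow]
        calc |c i s - c i t| ^ 2 ≤ (2 * B i) ^ 2 := by gcongr
          _ = _ := by ring
    rw [tsum_zero] at key
    have h2 := key.sqrt
    rw [Real.sqrt_zero] at h2
    refine h2.congr fun s => ?_
    rw [← Real.sqrt_sq (norm_nonneg (_ - _)), ← (hasSum_sq_inner b _).tsum_eq]
    simp only [inner_sub_right, hcoord]

end Hilbert

/-! ### The linear problem with scalar forcing in a fixed direction -/

section Linear

variable {ι V : Type*} [NormedAddCommGroup V] [InnerProductSpace ℝ V]

/-- The Hilbert basis `b` of `V` diagonalizes the bilinear form `J`, with eigenvalues `μ i` in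
`(0, θ]` where `θ < 1`. -/
structure Diagonalizes (b : HilbertBasis ι ℝ V) (J : V →L[ℝ] V →L[ℝ] ℝ) (μ : ι → ℝ) (θ : ℝ) :
    Prop where
  apply_basis : ∀ i u, J u (b i) = μ i * inner ℝ (b i) u
  pos : ∀ i, 0 < μ i
  le : ∀ i, μ i ≤ θ
  lt_one : θ < 1

/-- `u` is a continuous curve in `V` with `(J u)' + A u = -r d` in `V'` for `t > 0`, where
`A u = ⟨u, ·⟩ - J u`. -/
structure IsLinearSolution (J : V →L[ℝ] V →L[ℝ] ℝ) (d : V →L[ℝ] ℝ) (r : ℝ≥0 → ℝ)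
    (u : ℝ≥0 → V) : Prop where
  continuous : Continuous u
  hasDerivAt : ∀ t : ℝ≥0, 0 < t → HasDerivAt (fun s : ℝ => J (u s.toNNReal))
    (-(innerSL ℝ (u t) - J (u t)) - r t • d) (t : ℝ)

variable {b : HilbertBasis ι ℝ V} {J : V →L[ℝ] V →L[ℝ] ℝ} {μ : ι → ℝ} {θ : ℝ}
  {d : V →L[ℝ] ℝ}

lemma IsLinearSolution.sub {r₁ r₂ : ℝ≥0 → ℝ} {u₁ u₂ : ℝ≥0 → V}
    (h₁ : IsLinearSolution J d r₁ u₁) (h₂ : IsLinearSolution J d r₂ u₂) :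
    IsLinearSolution J d (fun t => r₁ t - r₂ t) (fun t => u₁ t - u₂ t) where
  continuous := h₁.continuous.sub h₂.continuous
  hasDerivAt t ht := by
    have h := (h₁.hasDerivAt t ht).sub (h₂.hasDerivAt t ht)
    simp only [map_sub]
    refine h.congr_deriv ?_
    module

lemma hasDerivAt_comp_toNNReal_add {E : Type*} [NormedAddCommGroup E] [NormedSpace ℝ E]
    {g : ℝ≥0 → E} {g' : E} {t s : ℝ≥0} (ht : 0 < t)
    (h : HasDerivAt (fun x : ℝ => g x.toNNReal) g' ((t + s : ℝ≥0) : ℝ)) :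
    HasDerivAt (fun x : ℝ => g (x.toNNReal + s)) g' (t : ℝ) := by
  rw [NNReal.coe_add] at h
  refine (h.comp_add_const (t : ℝ) (s : ℝ)).congr_of_eventuallyEq ?_
  filter_upwards [lt_mem_nhds (show (0 : ℝ) < t by exact_mod_cast ht)] with x hx
  rw [Real.toNNReal_add hx.le s.coe_nonneg, Real.toNNReal_coe]

lemma IsLinearSolution.shift {r : ℝ≥0 → ℝ} {u : ℝ≥0 → V} (h : IsLinearSolution J d r u)
    (s : ℝ≥0) : IsLinearSolution J d (fun t => r (t + s)) (fun t => u (t + s)) where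
  continuous := h.continuous.comp (continuous_add_const s)
  hasDerivAt t ht :=
    hasDerivAt_comp_toNNReal_add (g := fun x => J (u x)) ht
      (h.hasDerivAt (t + s) (ht.trans_le le_self_add))

lemma Diagonalizes.denom_pos (h : Diagonalizes b J μ θ) (i : ι) {γ : ℝ} (hγ : 0 ≤ γ) :
    1 - θ ≤ 1 - μ i + γ * μ i := by
  have := h.le i
  have := mul_nonneg hγ (h.pos i).le
  linarith

/-- A bound for the squared norm of the solution operator of the linear problem with forcing in the direction
`d`, measured in the sup norm with the weight `exp (-γ t)`. -/
noncomputable def forcingBound (b : HilbertBasis ι ℝ V) (μ : ι → ℝ) (d : V →L[ℝ] ℝ) (γ : ℝ) : ℝ :=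
  ∑' i, (d (b i) / (1 - μ i + γ * μ i)) ^ 2

lemma forcingTerm_le (h : Diagonalizes b J μ θ) {γ : ℝ} (hγ : 0 ≤ γ) (i : ι) :
    (d (b i) / (1 - μ i + γ * μ i)) ^ 2 ≤ d (b i) ^ 2 * ((1 - θ) ^ 2)⁻¹ := by
  rw [div_pow, div_eq_mul_inv]
  have h1 := h.denom_pos i hγ
  have h2 : 0 < 1 - θ := sub_pos.2 h.lt_one
  gcongr

lemma forcing_summable [CompleteSpace V] (h : Diagonalizes b J μ θ) {γ : ℝ} (hγ : 0 ≤ γ) :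
    Summable fun i => (d (b i) / (1 - μ i + γ * μ i)) ^ 2 :=
  ((summable_sq_apply b d).mul_right _).of_nonneg_of_le (fun _ => sq_nonneg _)
    (forcingTerm_le h hγ)

/-- Each term vanishes in the limit because `μ i > 0`, and the spectral gap supplies a summable
majorant independent of `γ`. Dominated convergence gives smallness without a rate. -/
lemma tendsto_forcingBound [CompleteSpace V] (h : Diagonalizes b J μ θ) :
    Tendsto (forcingBound b μ d) atTop (𝓝 0) := by
  have key : Tendsto (forcingBound b μ d) atTop (𝓝 (∑' _ : ι, 0)) := by
    refine tendsto_tsum_of_dominated_convergence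
      ((summable_sq_apply b d).mul_right ((1 - θ) ^ 2)⁻¹) (fun i => ?_) ?_
    · have h1 : Tendsto (fun γ : ℝ => 1 - μ i + γ * μ i) atTop atTop :=
        tendsto_atTop_add_const_left _ _ (tendsto_id.atTop_mul_const (h.pos i))
      simpa using (h1.const_div_atTop (d (b i))).pow 2
    · filter_upwards [eventually_ge_atTop 0] with γ hγ i
      rw [Real.norm_of_nonneg (sq_nonneg _)]
      exact forcingTerm_le h hγ i
  rwa [tsum_zero] at key

/-- Test the equation against `b i`, where `J` acts as multiplication by `μ i`, and divide by `μ i`.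
-/
lemma hasDerivAt_coordinate (h : Diagonalizes b J μ θ) {r : ℝ≥0 → ℝ} {u : ℝ≥0 → V}
    (hu : IsLinearSolution J d r u) (i : ι) {t : ℝ} (ht : 0 < t) :
    HasDerivAt (fun s : ℝ => inner ℝ (b i) (u s.toNNReal))
      (-(1 / μ i - 1) * inner ℝ (b i) (u t.toNNReal) - d (b i) / μ i * r t.toNNReal) t := by
  have h1 := hu.hasDerivAt t.toNNReal (Real.toNNReal_pos.2 ht)
  rw [Real.coe_toNNReal t ht.le] at h1
  have h2 := (h1.clm_apply (hasDerivAt_const t (b i))).div_const (μ i)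
  have hμ := (h.pos i).ne'
  simp only [h.apply_basis, mul_div_cancel_left₀ _ hμ] at h2
  refine h2.congr_deriv ?_
  simp [h.apply_basis, real_inner_comm]
  field_simp

/-- The supremum in time is taken in each coordinate before summing squares. The factors 2 come from
`(x + y)² ≤ 2 (x² + y²)`. Only forcing before time `t` enters, as the maximum argument for Lipschitz
dependence requires. -/
lemma norm_sq_le_of_isLinearSolution [CompleteSpace V] (h : Diagonalizes b J μ θ)
    {r : ℝ≥0 → ℝ} {u : ℝ≥0 → V} (hu : IsLinearSolution J d r u) {γ R : ℝ} (hγ : 0 ≤ γ)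
    (hR : 0 ≤ R) {t : ℝ≥0} (hr : ∀ s < t, |r s| ≤ R * Real.exp (γ * s)) :
    ‖u t‖ ^ 2 ≤ 2 * Real.exp (-(1 - θ) * t) ^ 2 * ‖u 0‖ ^ 2 +
      2 * (R * Real.exp (γ * t)) ^ 2 * forcingBound b μ d γ := by
  have hsum := ((hasSum_sq_inner b (u 0)).mul_left (2 * Real.exp (-(1 - θ) * t) ^ 2)).add
    ((forcing_summable (d := d) h hγ).hasSum.mul_left (2 * (R * Real.exp (γ * t)) ^ 2))
  refine hasSum_le (fun i => ?_) (hasSum_sq_inner b (u t)) hsum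
  have hμ := h.pos i
  have h1 : 1 - θ ≤ 1 / μ i - 1 := by
    have : 1 - μ i ≤ 1 / μ i - 1 := by
      rw [← sub_nonneg]
      have : 1 / μ i - 1 - (1 - μ i) = (1 - μ i) ^ 2 / μ i := by field_simp
      rw [this]; positivity
    linarith [h.le i]
  have h0 : 0 < 1 - θ := sub_pos.2 h.lt_one
  have hc : Continuous fun s : ℝ => inner ℝ (b i) (u s.toNNReal) :=
    continuous_const.inner (hu.continuous.comp continuous_real_toNNReal)
  have key := abs_le_of_hasDerivAt_linear (c := fun s : ℝ => inner ℝ (b i) (u s.toNNReal))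
    (r := fun s => r s.toNNReal) (lam := 1 / μ i - 1) (κ := d (b i) / μ i) (R := R) (γ := γ)
    t.coe_nonneg (by linarith) hR hc.continuousOn
    (fun s hs => hasDerivAt_coordinate h hu i hs.1) (fun s hs => by
      have := hr s.toNNReal (by
        rw [Real.toNNReal_lt_iff_lt_coe hs.1.le]; exact hs.2)
      rwa [Real.coe_toNNReal s hs.1.le] at this)
  simp only [Real.toNNReal_coe, Real.toNNReal_zero] at key
  have hden : 0 < 1 - μ i + γ * μ i := h0.trans_le (h.denom_pos i hγ)
  have h2 : |d (b i) / μ i| * R * Real.exp (γ * t) / (1 / μ i - 1 + γ) =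
      R * Real.exp (γ * t) * |d (b i) / (1 - μ i + γ * μ i)| := by
    rw [abs_div, abs_div, abs_of_pos hμ, abs_of_pos hden]
    have : 1 / μ i - 1 + γ = (1 - μ i + γ * μ i) / μ i := by field_simp
    rw [this]
    field_simp
  rw [h2] at key
  have h3 : Real.exp (-(1 / μ i - 1) * t) ≤ Real.exp (-(1 - θ) * t) := by
    gcongr
  have h4 : |inner ℝ (b i) (u t)| ≤ Real.exp (-(1 - θ) * t) * |inner ℝ (b i) (u 0)| +
      R * Real.exp (γ * t) * |d (b i) / (1 - μ i + γ * μ i)| :=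
    key.trans (by gcongr)
  rw [← sq_abs (inner ℝ (b i) (u t)), ← sq_abs (inner ℝ (b i) (u 0)),
    ← sq_abs (d (b i) / (1 - μ i + γ * μ i))]
  calc |inner ℝ (b i) (u t)| ^ 2 ≤ _ := pow_le_pow_left₀ (abs_nonneg _) h4 2
    _ ≤ 2 * ((Real.exp (-(1 - θ) * t) * |inner ℝ (b i) (u 0)|) ^ 2 +
      (R * Real.exp (γ * t) * |d (b i) / (1 - μ i + γ * μ i)|) ^ 2) := add_sq_le
    _ = _ := by ring

/-- Existence for the linear problem with bounded continuous forcing. -/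
lemma exists_isLinearSolution [CompleteSpace V] (h : Diagonalizes b J μ θ) (d : V →L[ℝ] ℝ)
    {r : ℝ≥0 → ℝ} (hr : Continuous r) {R : ℝ} (hrR : ∀ t, |r t| ≤ R) (u₀ : V) :
    ∃ u, IsLinearSolution J d r u ∧ u 0 = u₀ := by
  have hR : 0 ≤ R := (abs_nonneg _).trans (hrR 0)
  have h0 : 0 < 1 - θ := sub_pos.2 h.lt_one
  have hr' : Continuous fun s : ℝ => r s.toNNReal := hr.comp continuous_real_toNNReal
  -- Variation of constants in each coordinate.
  set c : ι → ℝ → ℝ := fun i t => Real.exp (-(1 / μ i - 1) * t) * (inner ℝ (b i) u₀ -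
    d (b i) / μ i * ∫ s in (0 : ℝ)..t, Real.exp ((1 / μ i - 1) * s) * r s.toNNReal) with hcdef
  have hder : ∀ i t, HasDerivAt (c i)
      (-(1 / μ i - 1) * c i t - d (b i) / μ i * r t.toNNReal) t := by
    intro i t
    have hcont : Continuous fun s : ℝ => Real.exp ((1 / μ i - 1) * s) * r s.toNNReal := by fun_prop
    have h1 := (hcont.integral_hasStrictDerivAt 0 t).hasDerivAt
    have h2 : HasDerivAt (fun s => Real.exp (-(1 / μ i - 1) * s))
        (Real.exp (-(1 / μ i - 1) * t) * (-(1 / μ i - 1))) t := by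
      simpa using ((hasDerivAt_id t).const_mul (-(1 / μ i - 1))).exp
    refine (h2.mul ((h1.const_mul (d (b i) / μ i)).const_sub (inner ℝ (b i) u₀))).congr_deriv ?_
    have h3 : Real.exp (-(1 / μ i - 1) * t) * Real.exp ((1 / μ i - 1) * t) = 1 := by
      rw [← Real.exp_add, ← Real.exp_zero]; congr 1; ring
    simp only [hcdef]
    linear_combination (-(d (b i) / μ i) * r t.toNNReal) * h3
  have hcc : ∀ i, Continuous (c i) := fun i =>
    continuous_iff_continuousAt.2 fun t => (hder i t).continuousAt
  have hc0 : ∀ i, c i 0 = inner ℝ (b i) u₀ := by intro i; simp [hcdef]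
  have hbound : ∀ i (t : ℝ≥0), |c i t| ≤ |inner ℝ (b i) u₀| + R * |d (b i) / (1 - μ i)| := by
    intro i t
    have hμ := h.pos i
    have hμ1 : 0 < 1 - μ i := by linarith [h.le i]
    have hlam : 1 / μ i - 1 = (1 - μ i) / μ i := by field_simp
    have hlam' : 0 < 1 / μ i - 1 := by rw [hlam]; positivity
    have key := abs_le_of_hasDerivAt_linear (R := R) (γ := 0) t.coe_nonneg
      (by linarith) hR (hcc i).continuousOn (fun s _ => hder i s) (fun s _ => by simpa using hrR _)
    refine key.trans ?_
    rw [hc0]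
    have h1 : Real.exp (-(1 / μ i - 1) * t) ≤ 1 := by
      rw [Real.exp_le_one_iff]
      have := mul_nonneg hlam'.le t.coe_nonneg
      linarith
    have h2 : |d (b i) / μ i| * R * Real.exp (0 * t) / (1 / μ i - 1 + 0) =
        R * |d (b i) / (1 - μ i)| := by
      rw [hlam, abs_div, abs_div, abs_of_pos hμ, abs_of_pos hμ1, zero_mul, Real.exp_zero]
      field_simp
      ring
    rw [h2]
    have := mul_le_of_le_one_left (abs_nonneg (inner ℝ (b i) u₀)) h1
    linarith
  have hB : Summable fun i => (|inner ℝ (b i) u₀| + R * |d (b i) / (1 - μ i)|) ^ 2 := by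
    have hs := ((hasSum_sq_inner b u₀).summable.mul_left 2).add
      ((forcing_summable (d := d) h le_rfl).mul_left (2 * R ^ 2))
    refine hs.of_nonneg_of_le (fun _ => sq_nonneg _) fun i => ?_
    rw [← sq_abs (inner ℝ (b i) u₀), zero_mul, add_zero, ← sq_abs (d (b i) / (1 - μ i))]
    calc _ ≤ _ := add_sq_le
      _ = _ := by ring
  obtain ⟨u, huc, hu⟩ := exists_continuous_of_coordinates b hB
    (fun i => (hcc i).comp NNReal.continuous_coe) hbound
  have hu' : ∀ i (s : ℝ), 0 ≤ s → inner ℝ (b i) (u s.toNNReal) = c i s := by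
    intro i s hs
    rw [hu, Function.comp_apply, Real.coe_toNNReal s hs]
  have hur : Continuous fun s : ℝ => u s.toNNReal := huc.comp continuous_real_toNNReal
  set g : ℝ → V →L[ℝ] ℝ := fun s =>
    -(innerSL ℝ (u s.toNNReal) - J (u s.toNNReal)) - r s.toNNReal • d with hg
  have hgc : Continuous g := by
    have h1 : Continuous fun s : ℝ => innerSL ℝ (u s.toNNReal) := (innerSL ℝ).continuous.comp hur
    have h2 : Continuous fun s : ℝ => J (u s.toNNReal) := J.continuous.comp hur
    exact ((h1.sub h2).neg).sub (hr'.smul continuous_const)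
  -- The integrated equation can be checked on basis vectors alone. Since `g` is norm continuous
  -- into the dual, differentiating the integral recovers the equation without differentiating a
  -- series.
  have hint : ∀ s : ℝ, 0 ≤ s → J (u s.toNNReal) = J (u 0) + ∫ x in (0 : ℝ)..s, g x := by
    intro s hs
    refine ext_basis b fun i => ?_
    have hμ := (h.pos i).ne'
    rw [add_apply,
      ContinuousLinearMap.intervalIntegral_apply (hgc.intervalIntegrable _ _),
      h.apply_basis, h.apply_basis, hu' i s hs, ← Real.toNNReal_zero, hu' i 0 le_rfl]
    have h1 : ∫ x in (0 : ℝ)..s, g x (b i) = ∫ x in (0 : ℝ)..s,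
        μ i * (-(1 / μ i - 1) * c i x - d (b i) / μ i * r x.toNNReal) := by
      refine intervalIntegral.integral_congr fun x hx => ?_
      rw [uIcc_of_le hs] at hx
      simp [hg, h.apply_basis, real_inner_comm (b i), hu' i x hx.1]
      field_simp
    rw [h1, intervalIntegral.integral_eq_sub_of_hasDerivAt
      (f := fun x => μ i * c i x) (fun x _ => (hder i x).const_mul (μ i))]
    · ring
    · refine Continuous.intervalIntegrable ?_ _ _
      have := hcc i
      fun_prop
  refine ⟨u, ⟨huc, fun t ht => ?_⟩, ?_⟩
  · have h1 := ((hgc.integral_hasStrictDerivAt 0 (t : ℝ)).hasDerivAt).const_add (J (u 0))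
    have h2 := h1.congr_of_eventuallyEq (f₁ := fun s : ℝ => J (u s.toNNReal)) (by
      filter_upwards [lt_mem_nhds (show (0 : ℝ) < t by exact_mod_cast ht)] with s hs
      exact hint s hs.le)
    simpa only [hg, Real.toNNReal_coe] using h2
  · refine b.repr.injective ?_
    ext i
    rw [b.repr_apply_apply, b.repr_apply_apply, hu]
    simp [hc0]

end Linear

/-! ### Decay under vanishing forcing, and the semilinear semiflow -/

section Semilinear

variable {ι V : Type*} [NormedAddCommGroup V] [InnerProductSpace ℝ V] [CompleteSpace V]
  {b : HilbertBasis ι ℝ V} {J : V →L[ℝ] V →L[ℝ] ℝ} {μ : ι → ℝ} {θ : ℝ} {d : V →L[ℝ] ℝ}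

/-- A solution of the linear problem tends to zero if its forcing does. -/
lemma tendsto_zero_of_isLinearSolution (h : Diagonalizes b J μ θ) {r : ℝ≥0 → ℝ} {u : ℝ≥0 → V}
    (hu : IsLinearSolution J d r u) (hr : Tendsto r atTop (𝓝 0)) : Tendsto u atTop (𝓝 0) := by
  have h0 : 0 < 1 - θ := sub_pos.2 h.lt_one
  suffices hsq : Tendsto (fun t => ‖u t‖ ^ 2) atTop (𝓝 0) by
    rw [tendsto_zero_iff_norm_tendsto_zero]
    simpa using hsq.sqrt
  refine tendsto_order.2 ⟨fun a ha => Eventually.of_forall fun t => ha.trans_le (sq_nonneg _),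
    fun η hη => ?_⟩
  obtain ⟨ε, hε, hεη⟩ : ∃ ε : ℝ, 0 < ε ∧ 2 * ε ^ 2 * forcingBound b μ d 0 < η / 2 := by
    have hcont : Tendsto (fun ε : ℝ => 2 * ε ^ 2 * forcingBound b μ d 0) (𝓝[>] 0) (𝓝 0) := by
      have : Continuous fun ε : ℝ => 2 * ε ^ 2 * forcingBound b μ d 0 := by fun_prop
      simpa using (this.tendsto 0).mono_left nhdsWithin_le_nhds
    exact ((eventually_mem_nhdsWithin).and (hcont.eventually_lt_const (half_pos hη))).exists
  -- Restarting at time `s` leaves a forcing below `ε` and a free part that decays from `u s`.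
  obtain ⟨s, hs⟩ := (hr.abs.eventually_lt_const (by simpa using hε)).exists_forall_of_atTop
  have hexp : Tendsto (fun t : ℝ≥0 => 2 * Real.exp (-(1 - θ) * t) ^ 2 * ‖u s‖ ^ 2) atTop (𝓝 0) := by
    have h1 : Tendsto (fun t : ℝ≥0 => Real.exp (-(1 - θ) * t)) atTop (𝓝 0) :=
      Real.tendsto_exp_atBot.comp
        ((tendsto_const_mul_atBot_of_neg (neg_lt_zero.2 h0)).2
          (NNReal.tendsto_coe_atTop.2 tendsto_id))
    simpa using ((h1.pow 2).const_mul 2).mul_const (‖u s‖ ^ 2)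
  obtain ⟨t₁, ht₁⟩ := (hexp.eventually_lt_const (half_pos hη)).exists_forall_of_atTop
  filter_upwards [eventually_ge_atTop (t₁ + s)] with t ht
  obtain ⟨x, rfl⟩ := exists_add_of_le ht
  have hkey := norm_sq_le_of_isLinearSolution h (hu.shift s) (γ := 0) (R := ε) (t := t₁ + x) le_rfl
    hε.le (fun y _ => by simpa using (hs (y + s) le_add_self).le)
  have h2 := ht₁ (t₁ + x) le_self_add
  simp only [zero_mul, Real.exp_zero, mul_one, zero_add] at hkey
  rw [show t₁ + s + x = t₁ + x + s by ring]
  linarith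

variable {F : V → ℝ} {K : ℝ≥0}

/-- With the constant 8, the forcing term `2 K² · forcingBound` is at most `1/4`, that is, a factor
`1/2` in norm. -/
lemma exists_weight (h : Diagonalizes b J μ θ) (d : V →L[ℝ] ℝ) (K : ℝ≥0) :
    ∃ γ : ℝ, 0 ≤ γ ∧ 8 * (K : ℝ) ^ 2 * forcingBound b μ d γ ≤ 1 := by
  have h1 := (tendsto_forcingBound (d := d) h).const_mul (8 * (K : ℝ) ^ 2)
  rw [mul_zero] at h1
  exact ((eventually_ge_atTop 0).and (h1.eventually_le_const one_pos)).exists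

/-- Lipschitz dependence on the initial value for the semilinear problem. -/
lemma norm_sub_le_of_semilinear (h : Diagonalizes b J μ θ) (hF : LipschitzWith K F) {γ : ℝ}
    (hγ : 0 ≤ γ) (hγK : 8 * (K : ℝ) ^ 2 * forcingBound b μ d γ ≤ 1) {u₁ u₂ : ℝ≥0 → V}
    (h₁ : IsLinearSolution J d (F ∘ u₁) u₁) (h₂ : IsLinearSolution J d (F ∘ u₂) u₂) (T : ℝ≥0) :
    ‖u₁ T - u₂ T‖ ≤ 2 * Real.exp (γ * T) * ‖u₁ 0 - u₂ 0‖ := by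
  have hw := h₁.sub h₂
  set g : ℝ≥0 → ℝ := fun s => Real.exp (-γ * s) * ‖u₁ s - u₂ s‖ with hg
  have hgc : Continuous g :=
    (Real.continuous_exp.comp (continuous_const.mul NNReal.continuous_coe)).mul hw.continuous.norm
  have hgw : ∀ s, ‖u₁ s - u₂ s‖ = g s * Real.exp (γ * s) := by
    intro s
    have : Real.exp (-γ * s) * Real.exp (γ * s) = 1 := by
      rw [← Real.exp_add, ← Real.exp_zero]; congr 1; ring
    simp only [hg]
    linear_combination (-‖u₁ s - u₂ s‖) * this
  have hg0 : ∀ s, 0 ≤ g s := fun s => by positivity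
  -- At the maximum of the weighted difference, the forcing term is at most a quarter of the left
  -- side and is absorbed: `(3/4) ‖w m‖² ≤ 2 ‖w 0‖²`, where `w = u₁ - u₂`.
  obtain ⟨m, hm, hmax⟩ := (isCompact_Icc (a := (0 : ℝ≥0)) (b := T)).exists_isMaxOn
    ⟨0, left_mem_Icc.2 zero_le⟩ hgc.continuousOn
  have hr : ∀ s < m, |(F ∘ u₁) s - (F ∘ u₂) s| ≤ K * g m * Real.exp (γ * s) := by
    intro s hs
    have h1 := hF.dist_le_mul (u₁ s) (u₂ s)
    rw [Real.dist_eq, dist_eq_norm, hgw] at h1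
    have h2 : g s ≤ g m := hmax ⟨zero_le, hs.le.trans hm.2⟩
    calc _ ≤ _ := h1
      _ = K * g s * Real.exp (γ * s) := by ring
      _ ≤ _ := by gcongr
  have key := norm_sq_le_of_isLinearSolution h hw hγ (mul_nonneg K.2 (hg0 m)) hr
  have he1 : Real.exp (-(1 - θ) * m) ^ 2 ≤ 1 := by
    refine pow_le_one₀ (Real.exp_nonneg _) (Real.exp_le_one_iff.2 ?_)
    have := mul_nonneg (sub_pos.2 h.lt_one).le m.coe_nonneg
    linarith
  have he2 : 1 ≤ Real.exp (γ * m) := Real.one_le_exp (mul_nonneg hγ m.coe_nonneg)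
  have h3 : 2 * (K * g m * Real.exp (γ * m)) ^ 2 * forcingBound b μ d γ ≤
      ‖u₁ m - u₂ m‖ ^ 2 / 4 := by
    have := mul_le_mul_of_nonneg_right hγK (sq_nonneg (‖u₁ m - u₂ m‖))
    rw [hgw] at this ⊢
    linarith
  have h4 : ‖u₁ m - u₂ m‖ ^ 2 ≤ (2 * ‖u₁ 0 - u₂ 0‖) ^ 2 := by
    have := mul_le_mul_of_nonneg_right he1 (sq_nonneg ‖u₁ 0 - u₂ 0‖)
    rw [one_mul] at this
    have h5 := key.trans (add_le_add_right h3 _)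
    rw [mul_assoc] at h5
    rw [mul_pow]
    generalize Real.exp (-(1 - θ) * m) ^ 2 * ‖u₁ 0 - u₂ 0‖ ^ 2 = a at *
    linarith [sq_nonneg ‖u₁ 0 - u₂ 0‖]
  have h5 : ‖u₁ m - u₂ m‖ ≤ 2 * ‖u₁ 0 - u₂ 0‖ := le_of_sq_le_sq h4 (by positivity)
  have h6 : g m ≤ 2 * ‖u₁ 0 - u₂ 0‖ := by
    rw [hgw] at h5
    exact (le_mul_of_one_le_right (hg0 m) he2).trans h5
  have h7 : g T ≤ g m := hmax (right_mem_Icc.2 zero_le)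
  rw [hgw T]
  calc g T * Real.exp (γ * T) ≤ 2 * ‖u₁ 0 - u₂ 0‖ * Real.exp (γ * T) := by
        gcongr; exact h7.trans h6
    _ = _ := by ring

/-- Global existence for the semilinear problem, by the contraction principle in the space of
continuous curves with the weighted sup norm. -/
lemma exists_semilinear (h : Diagonalizes b J μ θ) (d : V →L[ℝ] ℝ) (hF : LipschitzWith K F)
    {C : ℝ} (hC : ∀ v, |F v| ≤ C) (u₀ : V) :
    ∃ u, IsLinearSolution J d (F ∘ u) u ∧ u 0 = u₀ := by
  obtain ⟨γ, hγ, hγK⟩ := exists_weight h d K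
  have hC0 : 0 ≤ C := (abs_nonneg _).trans (hC 0)
  have hexp : ∀ a : ℝ, Continuous fun s : ℝ≥0 => Real.exp (a * s) := fun a => by fun_prop
  -- The unknown is `z = exp (-γ t) u`, so the weighted sup norm of `u` is the ordinary sup norm of
  -- `z`.
  have hcont : ∀ z : BoundedContinuousFunction ℝ≥0 V,
      Continuous fun s : ℝ≥0 => F (Real.exp (γ * s) • z s) := fun z =>
    hF.continuous.comp ((hexp γ).smul z.continuous)
  choose U hU hU0 using fun z : BoundedContinuousFunction ℝ≥0 V =>
    exists_isLinearSolution h d (hcont z) (R := C) (fun t => hC _) u₀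
  have hinv : ∀ s : ℝ≥0, Real.exp (γ * s) * Real.exp (-γ * s) = 1 := by
    intro s
    rw [← Real.exp_add, ← Real.exp_zero]; congr 1; ring
  have hle1 : ∀ s : ℝ≥0, Real.exp (-γ * s) ≤ 1 := by
    intro s
    have := mul_nonneg hγ s.coe_nonneg
    exact Real.exp_le_one_iff.2 (by linarith)
  have hle2 : ∀ s : ℝ≥0, Real.exp (-(1 - θ) * s) ^ 2 ≤ 1 := by
    intro s
    refine pow_le_one₀ (Real.exp_nonneg _) (Real.exp_le_one_iff.2 ?_)
    have := mul_nonneg (sub_pos.2 h.lt_one).le s.coe_nonneg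
    linarith
  have hbdd : ∀ z (t : ℝ≥0), ‖Real.exp (-γ * t) • U z t‖ ≤
      √(2 * ‖u₀‖ ^ 2 + 2 * C ^ 2 * forcingBound b μ d 0) := by
    intro z t
    have h1 := norm_sq_le_of_isLinearSolution h (hU z) (γ := 0) (t := t) le_rfl hC0
      (fun s _ => by simpa using hC _)
    have h2 := mul_le_mul_of_nonneg_right (hle2 t) (sq_nonneg ‖u₀‖)
    simp only [zero_mul, Real.exp_zero, mul_one, hU0] at h1
    refine Real.le_sqrt_of_sq_le ?_
    rw [norm_smul, Real.norm_of_nonneg (Real.exp_nonneg _)]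
    calc (Real.exp (-γ * t) * ‖U z t‖) ^ 2 ≤ ‖U z t‖ ^ 2 := by
          gcongr
          exact mul_le_of_le_one_left (norm_nonneg _) (hle1 t)
      _ ≤ _ := by linarith
  set Ψ : BoundedContinuousFunction ℝ≥0 V → BoundedContinuousFunction ℝ≥0 V := fun z =>
    BoundedContinuousFunction.ofNormedAddCommGroup (fun t : ℝ≥0 => Real.exp (-γ * t) • U z t)
      ((hexp (-γ)).smul (hU z).continuous) _ (hbdd z) with hΨ
  have hcontr : ContractingWith (1 / 2) Ψ := by
    refine ⟨by norm_num, LipschitzWith.of_dist_le_mul fun z z' => ?_⟩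
    refine (BoundedContinuousFunction.dist_le (by positivity)).2 fun t => ?_
    have hr : ∀ s < t, |F (Real.exp (γ * s) • z s) - F (Real.exp (γ * s) • z' s)| ≤
        K * dist z z' * Real.exp (γ * s) := by
      intro s _
      have h1 := hF.dist_le_mul (Real.exp (γ * s) • z s) (Real.exp (γ * s) • z' s)
      rw [Real.dist_eq, dist_smul₀, Real.norm_of_nonneg (Real.exp_nonneg _)] at h1
      have h2 : dist (z s) (z' s) ≤ dist z z' := BoundedContinuousFunction.dist_coe_le_dist s
      calc _ ≤ _ := h1
        _ ≤ K * (Real.exp (γ * s) * dist z z') := by gcongr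
        _ = _ := by ring
    have key := norm_sq_le_of_isLinearSolution h ((hU z).sub (hU z')) hγ (by positivity) hr
    simp only [hU0, sub_self, norm_zero] at key
    have h3 : ‖U z t - U z' t‖ ≤ 1 / 2 * dist z z' * Real.exp (γ * t) := by
      refine le_of_sq_le_sq ?_ (by positivity)
      have := mul_le_mul_of_nonneg_right hγK (sq_nonneg (dist z z' * Real.exp (γ * t)))
      linarith
    change dist (Real.exp (-γ * t) • U z t) (Real.exp (-γ * t) • U z' t) ≤ _
    rw [dist_smul₀, Real.norm_of_nonneg (Real.exp_nonneg _), dist_eq_norm]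
    calc Real.exp (-γ * t) * ‖U z t - U z' t‖
        ≤ Real.exp (-γ * t) * (1 / 2 * dist z z' * Real.exp (γ * t)) := by gcongr
      _ = 1 / 2 * dist z z' * (Real.exp (γ * t) * Real.exp (-γ * t)) := by ring
      _ = _ := by rw [hinv]; simp
  obtain ⟨z, hz⟩ : ∃ z, Ψ z = z := ⟨_, hcontr.fixedPoint_isFixedPt⟩
  have hzU : ∀ s : ℝ≥0, Real.exp (γ * s) • z s = U z s := by
    intro s
    have : z s = Real.exp (-γ * s) • U z s := congrArg (fun w => w s) hz.symm
    rw [this, smul_smul, hinv, one_smul]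
  refine ⟨U z, ?_, hU0 z⟩
  convert! hU z using 2 with s
  exact congrArg F (hzU s).symm

/-- The semilinear problem generates a continuous semiflow. -/
theorem exists_flow (h : Diagonalizes b J μ θ) (d : V →L[ℝ] ℝ) (hF : LipschitzWith K F)
    {C : ℝ} (hC : ∀ v, |F v| ≤ C) :
    ∃ Φ : Flow ℝ≥0 V, ∀ u₀ u,
      IsLinearSolution J d (F ∘ u) u ∧ u 0 = u₀ ↔ u = fun t => Φ t u₀ := by
  obtain ⟨γ, hγ, hγK⟩ := exists_weight h d K
  choose S hS hS0 using exists_semilinear h d hF hC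
  have huniq : ∀ u, IsLinearSolution J d (F ∘ u) u → u = S (u 0) := by
    intro u hu
    funext t
    have := norm_sub_le_of_semilinear h hF hγ hγK hu (hS (u 0)) t
    rw [hS0, sub_self, norm_zero, mul_zero] at this
    exact sub_eq_zero.1 (norm_le_zero_iff.1 this)
  refine ⟨⟨fun t u₀ => S u₀ t, ?_, ?_, hS0⟩, fun u₀ u => ⟨?_, ?_⟩⟩
  -- Joint continuity: Lipschitz dependence on the initial value, locally uniform in time, plus
  -- continuity of the single orbit through `x`.
  · rw [continuous_iff_continuousAt]
    rintro ⟨t, x⟩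
    rw [ContinuousAt, tendsto_iff_norm_sub_tendsto_zero]
    have hlim : Tendsto (fun p : ℝ≥0 × V => 2 * Real.exp (γ * p.1) * ‖p.2 - x‖ +
        ‖S x p.1 - S x t‖) (𝓝 (t, x)) (𝓝 0) := by
      have hSx := (hS x).continuous
      have : Continuous fun p : ℝ≥0 × V => 2 * Real.exp (γ * p.1) * ‖p.2 - x‖ +
        ‖S x p.1 - S x t‖ := by fun_prop
      simpa using this.tendsto (t, x)
    refine squeeze_zero (fun _ => norm_nonneg _) (fun p => ?_) hlim
    have h1 := norm_sub_le_of_semilinear h hF hγ hγK (hS p.2) (hS x) p.1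
    rw [hS0, hS0] at h1
    exact (norm_sub_le_norm_sub_add_norm_sub _ (S x p.1) _).trans
      (add_le_add_left h1 _)
  -- The semigroup law is uniqueness applied to a time-shifted solution.
  · intro t₁ t₂ x
    have := huniq _ ((hS x).shift t₂)
    rw [zero_add] at this
    exact congrFun this t₁
  · rintro ⟨hu, rfl⟩
    exact huniq u hu
  · rintro rfl
    exact ⟨hS u₀, hS0 u₀⟩

end Semilinear

/-! ### Spectral theorem for compact operators in Hilbert basis form -/

/-- An orthogonal family of closed subspaces whose sum is dense has an adapted Hilbert basis. -/
theorem exists_hilbertBasis_of_orthogonalFamily.{u, v} {κ : Type v} {V : Type u}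
    [NormedAddCommGroup V] [InnerProductSpace ℝ V] [CompleteSpace V] {W : κ → Submodule ℝ V}
    (hW : OrthogonalFamily ℝ (fun k => W k) fun k => (W k).subtypeₗᵢ)
    (hclosed : ∀ k, IsClosed (W k : Set V)) (hbot : (⨆ k, W k)ᗮ = ⊥) :
    ∃ (ι : Type max u v) (b : HilbertBasis ι ℝ V) (m : ι → κ), ∀ i, b i ∈ W (m i) := by
  have hcomplete : ∀ k, CompleteSpace (W k) := fun k => (hclosed k).completeSpace_coe
  choose w B hB using fun k => exists_hilbertBasis ℝ (W k)
  have horth : Orthonormal ℝ fun a : Σ k, w k => (W a.1).subtypeₗᵢ (B a.1 a.2) :=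
    hW.orthonormal_sigma_orthonormal fun k => (B k).orthonormal
  have hspan : (Submodule.span ℝ
      (Set.range fun a : Σ k, w k => (W a.1).subtypeₗᵢ (B a.1 a.2)))ᗮ = ⊥ := by
    rw [eq_bot_iff, ← hbot, ← Submodule.iInf_orthogonal]
    refine le_iInf fun k x hx => ?_
    rw [Submodule.mem_orthogonal'] at hx ⊢
    intro y hy
    have h0 : (innerSL ℝ x).comp (W k).subtypeL = 0 :=
      ext_basis (B k) fun i => hx _ (Submodule.subset_span ⟨⟨k, i⟩, rfl⟩)
    exact congrArg (fun φ => φ ⟨y, hy⟩) h0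
  refine ⟨_, HilbertBasis.mkOfOrthogonalEqBot horth hspan, fun a => a.1, fun a => ?_⟩
  rw [HilbertBasis.coe_mkOfOrthogonalEqBot]
  exact (B a.1 a.2).2

/-- A compact symmetric operator has a Hilbert basis of eigenvectors. -/
theorem exists_hilbertBasis_eigenvectors.{u} {V : Type u} [NormedAddCommGroup V]
    [InnerProductSpace ℝ V] [CompleteSpace V] {T : V →L[ℝ] V} (hT : IsCompactOperator T)
    (hT' : T.IsSymmetric) :
    ∃ (ι : Type u) (b : HilbertBasis ι ℝ V) (μ : ι → ℝ), ∀ i, T (b i) = μ i • b i := by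
  obtain ⟨ι, b, m, hb⟩ := exists_hilbertBasis_of_orthogonalFamily
    (W := fun m : ℝ => Module.End.eigenspace (T : Module.End ℝ V) m)
    hT'.orthogonalFamily_eigenspaces (fun m => by
      have : (Module.End.eigenspace (T : Module.End ℝ V) m : Set V) = {x | T x = m • x} := by
        ext x; exact Module.End.mem_eigenspace_iff
      rw [this]
      exact isClosed_eq T.continuous (continuous_const_smul m))
    (ContinuousLinearMap.orthogonalComplement_iSup_eigenspaces_eq_bot hT hT')
  exact ⟨ι, b, m, fun i => Module.End.mem_eigenspace_iff.1 (hb i)⟩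

/-- A compact operator `A` has a Hilbert basis of right singular vectors. -/
theorem exists_hilbertBasis_singularVectors.{u} {E : Type u} {F : Type*} [NormedAddCommGroup E]
    [InnerProductSpace ℝ E] [CompleteSpace E] [NormedAddCommGroup F] [InnerProductSpace ℝ F]
    [CompleteSpace F] {A : E →L[ℝ] F} (hA : IsCompactOperator A) :
    ∃ (ι : Type u) (b : HilbertBasis ι ℝ E) (μ : ι → ℝ),
      ∀ i u, inner ℝ (A u) (A (b i)) = μ i * inner ℝ (b i) u := by
  -- Right singular vectors are eigenvectors of the compact symmetric operator `A* A`.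
  have hinner : ∀ u v, inner ℝ ((A.adjoint.comp A) u) v = inner ℝ (A u) (A v) := fun u v =>
    A.adjoint_inner_left _ _
  have hsymm : (A.adjoint.comp A).IsSymmetric := by
    intro u v
    change inner ℝ ((A.adjoint.comp A) u) v = inner ℝ u ((A.adjoint.comp A) v)
    rw [hinner, real_inner_comm _ u, hinner, real_inner_comm]
  obtain ⟨ι, b, μ, hb⟩ := exists_hilbertBasis_eigenvectors (hA.clm_comp A.adjoint) hsymm
  refine ⟨ι, b, μ, fun i u => ?_⟩
  rw [real_inner_comm, ← hinner, hb, real_inner_smul_left]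

lemma isCompactOperator_of_norm_sub_le {E F : Type*} [NormedAddCommGroup E] [NormedSpace ℝ E]
    [NormedAddCommGroup F] [NormedSpace ℝ F] [CompleteSpace F] {P : ℕ → E →L[ℝ] F} {T : E →L[ℝ] F}
    (hP : ∀ n, IsCompactOperator (P n)) {a : ℕ → ℝ} (ha : Tendsto a atTop (𝓝 0))
    (h : ∀ n, ‖P n - T‖ ≤ a n) : IsCompactOperator T :=
  isCompactOperator_of_tendsto (tendsto_iff_norm_sub_tendsto_zero.2
    (squeeze_zero (fun _ => norm_nonneg _) h ha)) (Eventually.of_forall hP)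

/-! ### Poincaré inequality, compact embedding and diagonalization on `H¹₀` -/

section Sobolev

variable {L : ℝ}

lemma inner_eq_incl_add_dirichletOp (u v : H10 L) :
    inner ℝ u v = incl L u v + dirichletOp L u v :=
  WithLp.prod_inner_apply _ _

lemma dirichletOp_eq (u : H10 L) : dirichletOp L u = innerSL ℝ u - incl L u := by
  ext v
  rw [sub_apply, innerSL_apply_apply, inner_eq_incl_add_dirichletOp]
  ring

lemma norm_sq_eq (u : H10 L) : ‖u‖ ^ 2 = ‖val L u‖ ^ 2 + ‖grad L u‖ ^ 2 := by
  rw [← real_inner_self_eq_norm_sq, inner_eq_incl_add_dirichletOp, ← real_inner_self_eq_norm_sq,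
    ← real_inner_self_eq_norm_sq]
  rfl

lemma norm_grad_le (u : H10 L) : ‖grad L u‖ ≤ ‖u‖ := by
  refine le_of_sq_le_sq ?_ (norm_nonneg _)
  rw [norm_sq_eq]
  linarith [sq_nonneg ‖val L u‖]

lemma norm_le_of_ae_abs_le (hL : 0 < L) {f : L2 L} {C : ℝ} (hC : 0 ≤ C)
    (h : ∀ᵐ x ∂volume.restrict (Ioo (-L) L), |f x| ≤ C) : ‖f‖ ≤ √(2 * L) * C := by
  have h1 := Lp.norm_le_of_ae_bound (f := f) hC h
  refine h1.trans (le_of_eq ?_)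
  congr 1
  have : measureUnivNNReal (volume.restrict (Ioo (-L) L)) = (2 * L).toNNReal := by
    rw [measureUnivNNReal, Measure.restrict_apply_univ, Real.volume_Ioo, sub_neg_eq_add, ← two_mul]
    rfl
  rw [this, Real.sqrt_eq_rpow]
  simp [hL.le]

/-- Cauchy-Schwarz for the integral of an `L²` function over a set. -/
lemma abs_setIntegral_le (f : L2 L) {s : Set ℝ} (hs : MeasurableSet s) {m : ℝ}
    (hm : (volume.restrict (Ioo (-L) L)).real s ≤ m) :
    |∫ x in s, f x ∂volume.restrict (Ioo (-L) L)| ≤ √m * ‖f‖ := by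
  rw [← L2.inner_indicatorConstLp_one hs (measure_ne_top _ _)]
  refine (abs_real_inner_le_norm _ _).trans ?_
  gcongr
  rw [norm_indicatorConstLp (by simp) (by simp), Real.sqrt_eq_rpow]
  simp only [norm_one, one_mul, ENNReal.toReal_ofNat]
  gcongr

lemma abs_delta_le (hL : 0 < L) (x : ℝ) (u : H10 L) : |delta L x u| ≤ √(2 * L) * ‖grad L u‖ := by
  rw [delta_apply]
  refine abs_setIntegral_le _ measurableSet_Iic ((measureReal_mono (subset_univ _)).trans ?_)
  simp [Measure.real, two_mul, hL.le]

lemma abs_delta_sub_le {x y : ℝ} (hxy : x ≤ y) (u : H10 L) :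
    |delta L y u - delta L x u| ≤ √(y - x) * ‖grad L u‖ := by
  have hint : Integrable (grad L u) (volume.restrict (Ioo (-L) L)) :=
    (Lp.memLp _).integrable one_le_two
  have h1 : delta L y u - delta L x u =
      ∫ s in Ioc x y, grad L u s ∂volume.restrict (Ioo (-L) L) := by
    rw [delta_apply, delta_apply, ← intervalIntegral.integral_of_le hxy]
    exact intervalIntegral.integral_Iic_sub_Iic hint.integrableOn hint.integrableOn
  rw [h1]
  refine abs_setIntegral_le _ measurableSet_Ioc ?_
  rw [Measure.real, ← ENNReal.toReal_ofReal (sub_nonneg.2 hxy), ← Real.volume_Ioc]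
  exact ENNReal.toReal_mono (by simp) (Measure.restrict_apply_le _ _)

/-- The Poincaré inequality. -/
lemma norm_val_le (hL : 0 < L) (u : H10 L) : ‖val L u‖ ≤ 2 * L * ‖grad L u‖ := by
  have h := norm_le_of_ae_abs_le (f := val L u) hL
    (C := √(2 * L) * ‖grad L u‖) (by positivity) (by
      filter_upwards [val_ae_eq_delta L u] with x hx
      rw [hx]; exact abs_delta_le hL x u)
  rwa [← mul_assoc, Real.mul_self_sqrt (by positivity)] at h

/-- Integration by parts. -/
lemma inner_grad_add_inner_val {φ : ℝ → ℝ} (hφ : IsTestFunction L φ) {w : H10 L}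
    (hw : val L w =ᵐ[volume.restrict (Ioo (-L) L)] φ)
    (hw' : grad L w =ᵐ[volume.restrict (Ioo (-L) L)] deriv φ) (u : H10 L) :
    inner ℝ (grad L u) (val L w) + inner ℝ (val L u) (grad L w) = 0 := by
  have hclosed : IsClosed {x : WithLp 2 (L2 L × L2 L) |
      inner ℝ (WithLp.sndL 2 ℝ (L2 L) (L2 L) x) (val L w) +
        inner ℝ (WithLp.fstL 2 ℝ (L2 L) (L2 L) x) (grad L w) = 0} :=
    isClosed_eq (by fun_prop) continuous_const
  refine closure_minimal ?_ hclosed u.2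
  rintro x ⟨ψ, hψ, h1, h2⟩
  change inner ℝ x.snd (val L w) + inner ℝ x.fst (grad L w) = 0
  have hcψ := hψ.continuous_deriv
  have hcφ := hφ.continuous_deriv
  have i1 : Integrable (ψ * deriv φ) :=
    (hψ.smooth.continuous.mul hcφ).integrable_of_hasCompactSupport hφ.compact.deriv.mul_left
  have i2 : Integrable (deriv ψ * φ) :=
    (hcψ.mul hφ.smooth.continuous).integrable_of_hasCompactSupport hφ.compact.mul_left
  have i3 : Integrable (ψ * φ) :=
    (hψ.smooth.continuous.mul hφ.smooth.continuous).integrable_of_hasCompactSupport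
      hφ.compact.mul_left
  have hparts : ∫ x, ψ x * deriv φ x = -∫ x, deriv ψ x * φ x :=
    integral_mul_deriv_eq_deriv_mul_of_integrable
      (fun x _ => (hψ.smooth.differentiable (by simp) x).hasDerivAt)
      (fun x _ => (hφ.smooth.differentiable (by simp) x).hasDerivAt) i1 i2 i3
  have hφ0 : ∀ x, x ∉ Ioo (-L) L → φ x = 0 := fun x hx =>
    image_eq_zero_of_notMem_tsupport fun h => hx (hφ.support h)
  have hφ0' : ∀ x, x ∉ Ioo (-L) L → deriv φ x = 0 := fun x hx =>
    Function.notMem_support.1 fun h => hx (hφ.support (support_deriv_subset h))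
  have e1 : inner ℝ x.snd (val L w) = ∫ x, deriv ψ x * φ x := by
    rw [L2.inner_def, ← setIntegral_eq_integral_of_forall_compl_eq_zero (s := Ioo (-L) L)
      (f := fun x => deriv ψ x * φ x) (fun x hx => by rw [hφ0 x hx, mul_zero])]
    refine integral_congr_ae ?_
    filter_upwards [h2, hw] with y hy hy'
    rw [hy, hy', mul_comm]; rfl
  have e2 : inner ℝ x.fst (grad L w) = ∫ x, ψ x * deriv φ x := by
    rw [L2.inner_def, ← setIntegral_eq_integral_of_forall_compl_eq_zero (s := Ioo (-L) L)
      (f := fun x => ψ x * deriv φ x) (fun x hx => by rw [hφ0' x hx, mul_zero])]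
    refine integral_congr_ae ?_
    filter_upwards [h1, hw'] with y hy hy'
    rw [hy, hy', mul_comm]; rfl
  rw [e1, e2, hparts]
  ring

/-- Elements are pairs, so the function must be shown to determine its derivative: integration by
parts makes `grad L u` orthogonal to all test functions. This injectivity makes every `μ i`
positive. -/
lemma eq_zero_of_val_eq_zero {u : H10 L} (hu : val L u = 0) : u = 0 := by
  have hint : Integrable (grad L u) (volume.restrict (Ioo (-L) L)) :=
    (Lp.memLp _).integrable one_le_two
  have h := isOpen_Ioo.ae_eq_zero_of_integral_contDiff_smul_eq_zero
    (f := grad L u) (hint.locallyIntegrable.locallyIntegrableOn (Ioo (-L) L))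
    (fun φ h1 h2 h3 => by
      obtain ⟨w, hw, hw'⟩ := exists_of_test (L := L) ⟨h1, h2, h3⟩
      have := inner_grad_add_inner_val ⟨h1, h2, h3⟩ hw hw' u
      rw [hu, inner_zero_left, add_zero, L2.inner_def] at this
      rw [← this]
      refine integral_congr_ae ?_
      filter_upwards [hw] with y hy
      rw [hy]; rfl)
  have hg : grad L u = 0 := by
    refine (Lp.eq_zero_iff_ae_eq_zero).2 ?_
    filter_upwards [h, ae_restrict_mem measurableSet_Ioo] with x hx hxL using hx hxL
  have := norm_sq_eq u
  rw [hu, hg] at this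
  simpa using this

/-- The embedding `H¹₀ → L²` is compact: it is a limit of operators of finite rank, which replace
a function by a step function. -/
lemma isCompactOperator_val (hL : 0 < L) : IsCompactOperator (val L) := by
  set h : ℕ → ℝ := fun n => 2 * L / (n + 1) with hh
  have hpos : ∀ n, 0 < h n := fun n => by positivity
  -- Cells of length `h n`; `P n` samples `u` at left endpoints. The natural floor also puts all `x
  -- < -L` into cell 0, which the restricted measure ignores. The `1/2`-Hölder bound makes the error
  -- `O(√(h n))`.
  set S : ℕ → ℕ → Set ℝ := fun n j => {x | ⌊(x + L) / h n⌋₊ = j} with hS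
  have hSm : ∀ n j, MeasurableSet (S n j) := fun n j => by
    have : Measurable fun x : ℝ => ⌊(x + L) / h n⌋₊ :=
      Nat.measurable_floor.comp ((measurable_id.add_const L).div_const (h n))
    exact this (measurableSet_singleton j)
  set e : ℕ → ℕ → L2 L := fun n j =>
    indicatorConstLp 2 (hSm n j) (measure_ne_top _ _) (1 : ℝ) with he
  set P : ℕ → H10 L →L[ℝ] L2 L := fun n =>
    ∑ j ∈ Finset.range (n + 1), (delta L (-L + j * h n)).smulRight (e n j) with hP
  have hPc : ∀ n, IsCompactOperator (P n) := by
    intro n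
    refine (compactOperator (RingHom.id ℝ) (H10 L) (L2 L)).sum_mem fun j _ => ?_
    have : IsCompactOperator (delta L (-L + j * h n)) :=
      isCompactOperator_of_locallyCompactSpace_dom _
    exact this.clm_comp (ContinuousLinearMap.toSpanSingleton ℝ (e n j))
  have hbound : ∀ n, ‖P n - val L‖ ≤ √(2 * L) * √(h n) := by
    intro n
    refine ContinuousLinearMap.opNorm_le_bound _ (by positivity) fun u => ?_
    rw [mul_assoc]
    refine norm_le_of_ae_abs_le hL (by positivity) ?_
    have hPu : P n u = ∑ j ∈ Finset.range (n + 1), delta L (-L + j * h n) u • e n j := by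
      simp [hP]
    have hcoe : ∀ᵐ x ∂volume.restrict (Ioo (-L) L), ∀ j : ℕ,
        (delta L (-L + j * h n) u • e n j : L2 L) x =
          if ⌊(x + L) / h n⌋₊ = j then delta L (-L + j * h n) u else 0 := by
      refine ae_all_iff.2 fun j => ?_
      filter_upwards [Lp.coeFn_smul (delta L (-L + j * h n) u) (e n j),
        indicatorConstLp_coeFn (p := 2) (hs := hSm n j)
          (hμs := measure_ne_top (volume.restrict (Ioo (-L) L)) _) (c := (1 : ℝ))] with x hx hx'
      rw [hx, Pi.smul_apply, he, hx']
      simp [indicator, hS]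
    filter_upwards [Lp.coeFn_sub (P n u) (val L u), hcoe, val_ae_eq_delta L u,
      ae_restrict_mem measurableSet_Ioo,
      Lp.coeFn_finsetSum (Finset.range (n + 1)) (fun j => delta L (-L + j * h n) u • e n j)]
      with x h1 h2 h3 hx h4
    have hy0 : 0 ≤ (x + L) / h n := div_nonneg (by linarith [hx.1]) (hpos n).le
    have hyn : ⌊(x + L) / h n⌋₊ < n + 1 := by
      rw [Nat.floor_lt hy0, div_lt_iff₀ (hpos n)]
      have : ((n + 1 : ℕ) : ℝ) * h n = 2 * L := by
        simp only [hh]; push_cast; field_simp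
      linarith [hx.2]
    have h5 : (P n - val L) u = P n u - val L u := rfl
    rw [h5, h1, Pi.sub_apply, h3, hPu, h4]
    simp only [Finset.sum_apply, h2, Finset.sum_ite_eq, Finset.mem_range, hyn, if_true]
    set j := ⌊(x + L) / h n⌋₊ with hj
    have hj1 : (j : ℝ) * h n ≤ x + L := (le_div_iff₀ (hpos n)).1 (Nat.floor_le hy0)
    have hj2 : x + L < (j + 1) * h n := (div_lt_iff₀ (hpos n)).1 (Nat.lt_floor_add_one _)
    rw [abs_sub_comm]
    refine (abs_delta_sub_le (by linarith) u).trans ?_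
    gcongr
    · linarith
    · exact norm_grad_le u
  refine isCompactOperator_of_norm_sub_le hPc ?_ hbound
  have h1 : Tendsto h atTop (𝓝 0) := by
    simpa [hh, div_eq_mul_inv] using
      (tendsto_one_div_add_atTop_nhds_zero_nat (𝕜 := ℝ)).const_mul (2 * L)
  simpa using h1.sqrt.const_mul (√(2 * L))

/-- The Dirichlet problem is diagonalized by a Hilbert basis of `H¹₀`. -/
theorem exists_diagonalizes (hL : 0 < L) :
    ∃ (ι : Type) (b : HilbertBasis ι ℝ (H10 L)) (μ : ι → ℝ) (θ : ℝ),
      Diagonalizes b (incl L) μ θ := by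
  obtain ⟨ι, b, μ, hb⟩ := exists_hilbertBasis_singularVectors (isCompactOperator_val hL)
  have hμ : ∀ i, μ i = ‖val L (b i)‖ ^ 2 := by
    intro i
    have h1 := hb i (b i)
    rw [real_inner_self_eq_norm_sq, real_inner_self_eq_norm_sq, b.orthonormal.1 i, one_pow,
      mul_one] at h1
    exact h1.symm
  -- For unit `b i`, Poincaré reads `μ i ≤ 4 L² (1 - μ i)`; solving for `μ i` gives this `θ`.
  refine ⟨ι, b, μ, 4 * L ^ 2 / (1 + 4 * L ^ 2), hb, fun i => ?_, fun i => ?_, ?_⟩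
  · rw [hμ]
    refine pow_pos (norm_pos_iff.2 fun h0 => ?_) 2
    exact b.orthonormal.ne_zero i (eq_zero_of_val_eq_zero h0)
  · have h1 := norm_sq_eq (b i)
    rw [b.orthonormal.1 i] at h1
    have h2 := pow_le_pow_left₀ (norm_nonneg _) (norm_val_le hL (b i)) 2
    rw [hμ, le_div_iff₀ (by positivity)]
    nlinarith
  · rw [div_lt_one (by positivity)]
    linarith

end Sobolev

end ParabolicOscillator

/-! ### The main theorem -/

theorem proposition6p1 (f : ℝ → ℝ) (hbdd : ∃ C : ℝ, ∀ y, |f y| ≤ C)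
    (hlip : ∃ K : ℝ≥0, LipschitzWith K f) (hf0 : f 0 = 0)
    (β L x₀ : ℝ) (hβ : 0 < β) (hL : 0 < L) (hx₀ : x₀ ∈ Set.Ioo 0 L) :
    (∃! Φ : Flow ℝ≥0 (ParabolicOscillator.H10 L),
      ParabolicOscillator.IsSemiflowOf f β L x₀ Φ) ∧
    ∀ Φ : Flow ℝ≥0 (ParabolicOscillator.H10 L),
      ParabolicOscillator.IsSemiflowOf f β L x₀ Φ →
      ∀ u₀ : ParabolicOscillator.H10 L,
        Tendsto (fun t : ℝ≥0 => Φ t u₀) atTop (𝓝 0) ↔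
          Tendsto (fun t : ℝ≥0 => ParabolicOscillator.delta L x₀ (Φ t u₀)) atTop (𝓝 0) := by
  open ParabolicOscillator in
  obtain ⟨C, hC⟩ := hbdd
  obtain ⟨K, hK⟩ := hlip
  obtain ⟨ι, b, μ, θ, hdiag⟩ := exists_diagonalizes hL
  set F : H10 L → ℝ := fun v => f (β * delta L x₀ v)
  have hFlip : LipschitzWith (K * ‖β • delta L x₀‖₊) F := hK.comp (β • delta L x₀).lipschitz
  have hsol : ∀ u₀ u, IsSolution f β L x₀ u₀ u ↔
      IsLinearSolution (incl L) (delta L 0) (F ∘ u) u ∧ u 0 = u₀ := by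
    refine fun u₀ u => ⟨fun h => ⟨⟨h.continuous, fun t ht => ?_⟩, h.initial⟩,
      fun h => ⟨h.1.continuous, h.2, fun t ht => ?_⟩⟩
    · rw [← dirichletOp_eq]; exact h.hasDerivAt t ht
    · rw [dirichletOp_eq]; exact h.1.hasDerivAt t ht
  refine ⟨?_, fun Φ hΦ u₀ => ⟨fun h => ?_, fun h => ?_⟩⟩
  · obtain ⟨Φ, hΦ⟩ := exists_flow hdiag (delta L 0) hFlip (fun v => hC _)
    have hΦ' : IsSemiflowOf f β L x₀ Φ := fun u₀ u => (hsol u₀ u).trans (hΦ u₀ u)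
    refine ⟨Φ, hΦ', fun Ψ hΨ => Flow.ext fun t u₀ => ?_⟩
    exact congrFun ((hΦ' u₀ _).1 ((hΨ u₀ _).2 rfl)) t
  · rw [← map_zero (delta L x₀)]
    exact ((delta L x₀).continuous.tendsto 0).comp h
  -- The orbit solves the linear problem whose forcing is the nonlinearity evaluated along the orbit
  -- itself.
  · refine tendsto_zero_of_isLinearSolution hdiag ((hsol u₀ _).1 ((hΦ u₀ _).2 rfl)).1 ?_
    have hcont : Tendsto (fun y => f (β * y)) (𝓝 0) (𝓝 0) := by
      have : Continuous fun y => f (β * y) := hK.continuous.comp (continuous_const_mul β)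
      simpa [hf0] using this.tendsto 0
    exact hcont.comp h
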